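/- Let $E$ be a real Banach space with dual $E^*$ and bidual $E^{**}$, and let $f\colon E\to\,]-\infty,\infty]$ be proper (that is, not identically $+\infty$), convex and lower semicontinuous. For a real Banach space $X$ and $g\colon X\to[-\infty,\infty]$ let $g^*\colon X^*\to[-\infty,\infty]$, $g^*(x^*)=\sup_{x\in X}\,[\langle x,x^*\rangle-g(x)]$, be the Fenchel conjugate, and let $\partial g\colon X\rightrightarrows X^*$ be the subdifferential: $x^*\in\partial g(x)$ if and only if $g(x)+g^*(x^*)=\langle x,x^*\rangle$. For a multifunction $S\colon E\rightrightarrows E^*$ with graph $G(S)$ let $$\varphi_S(x,x^*)=\sup_{(s,s^*)\in G(S)}\big[\langle s,x^*\rangle+\langle x,s^*\rangle-\langle s,s^*\rangle\big]\qquad((x,x^*)\in E\times E^*)$$ be its Fitzpatrick function, and identify $(E\times E^*)^*$ with $E^*\times E^{**}$ by $\langle (x,x^*),(y^*,y^{**})\rangle=\langle x,y^*\rangle+\langle x^*,y^{**}\rangle$. The Fitzpatrick extension $S^{\mathbb F}\colon E^*\rightrightarrows E^{**}$ of $S$ is defined by: $y^{**}\in S^{\mathbb F}(y^*)$ if and only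 if ${\varphi_S}^*(y^*,y^{**})=\langle y^*,y^{**}\rangle$. Then $$(\partial f)^{\mathbb F}=\partial(f^*),$$ as multifunctions from $E^*$ to $E^{**}$. -/

import Mathlib

noncomputable section

namespace FitzExt

/-- The class of proper convex lower semicontinuous functions `X → ]-∞, ∞]`. -/
structure IsPCLSC {X : Type*} [NormedAddCommGroup X] [NormedSpace ℝ X] (f : X → EReal) :
    Prop where
  /-- `f` takes its values in `]-∞, ∞]`. -/
  ne_bot : ∀ x, f x ≠ ⊥
  /-- The effective domain is nonempty. -/
  proper : ∃ x, f x ≠ ⊤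
  convex : ∀ x y : X, ∀ a b : ℝ, 0 < a → 0 < b → a + b = 1 →
    f (a • x + b • y) ≤ (a : EReal) * f x + (b : EReal) * f y
  lsc : LowerSemicontinuous f

/-- The Fenchel conjugate `f^* : X^* → [-∞, ∞]`, `f^*(x^*) = sup_X [x^* - f]`. -/
def conj {X : Type*} [NormedAddCommGroup X] [NormedSpace ℝ X] (f : X → EReal) :
    StrongDual ℝ X → EReal :=
  fun x' => ⨆ x : X, ((x' x : ℝ) : EReal) - f x

/-- The subdifferential `∂f : X ⇉ X^*`: `x^* ∈ ∂f(x)` iff `f(x) + f^*(x^*) = ⟨x, x^*⟩`. -/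
def subdiff {X : Type*} [NormedAddCommGroup X] [NormedSpace ℝ X] (f : X → EReal) :
    X → Set (StrongDual ℝ X) :=
  fun x => {x' | f x + conj f x' = ((x' x : ℝ) : EReal)}

/-- The graph of a multifunction `S : X ⇉ Y`. -/
def graph {X Y : Type*} (S : X → Set Y) : Set (X × Y) :=
  {p | p.2 ∈ S p.1}

/-- The Fitzpatrick function of `S : E ⇉ E^*`,
`φ_S(x, x^*) = sup_{(s, s^*) ∈ G(S)} [⟨s, x^*⟩ + ⟨x, s^*⟩ - ⟨s, s^*⟩]`. -/
def fitzFun {E : Type*} [NormedAddCommGroup E] [NormedSpace ℝ E]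
    (S : E → Set (StrongDual ℝ E)) : E × StrongDual ℝ E → EReal :=
  fun p => ⨆ s ∈ graph S, ((p.2 s.1 + s.2 p.1 - s.2 s.1 : ℝ) : EReal)

/-- The Fitzpatrick extension `S^𝔽 : E^* ⇉ E^{**}`: `y^{**} ∈ S^𝔽(y^*)` iff
`φ_S^*(y^*, y^{**}) = ⟨y^*, y^{**}⟩`. Here `(y^*, y^{**})` is read as the element
`(x, x^*) ↦ ⟨x, y^*⟩ + ⟨x^*, y^{**}⟩` of `(E × E^*)^*`, which is `y^*.coprod y^{**}`. -/
def fitzExt {E : Type*} [NormedAddCommGroup E] [NormedSpace ℝ E]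
    (S : E → Set (StrongDual ℝ E)) :
    StrongDual ℝ E → Set (StrongDual ℝ (StrongDual ℝ E)) :=
  fun y' => {y'' | conj (fitzFun S) (y'.coprod y'') = ((y'' y' : ℝ) : EReal)}

end FitzExt

end

/-!
By Fenchel–Young, `φ_{∂f} ≤ f ⊕ f^*`, hence `f^* ⊕ f^{**} ≤ φ_{∂f}^*`. This gives
`(∂f)^𝔽 ⊆ ∂(f^*)`, and also half of the equality defining `(∂f)^𝔽` at a point of `∂(f^*)`. The other
half says that `⟨x, y^*⟩ + ⟨x^*, y^{**}⟩ - ⟨y^*, y^{**}⟩ ≤ φ_{∂f}(x, x^*)` whenever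
`y^{**} ∈ ∂(f^*)(y^*)`. Put `w = x^* - y^*` and let `t > 0`. The subgradient inequality at
`z^* = y^* + t w` gives `u₀` with `⟨u₀, z^*⟩ - f(u₀) > f^*(y^*) + t ⟨w, y^{**}⟩ - t²`. For small
`ε > 0` the penalty `ε² ‖· - x‖²` is at most `t²` at `u₀`, and it makes `f - z^* + ε² ‖· - x‖²`
bounded below, since `f ≥ y^* - f^*(y^*)`. Ekeland's principle started at `u₀`, followed by the sum
rule for subdifferentials, gives a pair `(s, s^*) ∈ G(∂f)` with `⟨s, w⟩ ≥ ⟨w, y^{**}⟩ - 2t` and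
`⟨s - x, s^* - z^*⟩ ≤ t²`. No bound on `s` is needed, because these two estimates already bound
`⟨s, x^*⟩ + ⟨x, s^*⟩ - ⟨s, s^*⟩` from below, by a quantity tending to the left-hand side as `t → 0`.
-/

namespace FitzExt

open Filter Topology
open scoped ENNReal

section Ekeland

/-- The points `v` at which `φ` lies below `φ u` by at least `l` times the distance from `v` to `u`.
These sets are the descending sections of the partial order behind Ekeland's principle. -/
def descentSet {X : Type*} [EDist X] (φ : X → ℝ≥0∞) (l : ℝ≥0∞) (u : X) : Set X :=
  {v | φ v + l * edist v u ≤ φ u}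

variable {X : Type*}

theorem self_mem_descentSet [PseudoEMetricSpace X] (φ : X → ℝ≥0∞) (l : ℝ≥0∞) (u : X) :
    u ∈ descentSet φ l u := by
  simp [descentSet]

theorem le_of_mem_descentSet [EDist X] {φ : X → ℝ≥0∞} {l : ℝ≥0∞} {u v : X}
    (hv : v ∈ descentSet φ l u) : φ v ≤ φ u :=
  le_self_add.trans hv

theorem descentSet_subset [PseudoEMetricSpace X] {φ : X → ℝ≥0∞} {l : ℝ≥0∞} {u v : X}
    (hv : v ∈ descentSet φ l u) : descentSet φ l v ⊆ descentSet φ l u := fun w hw =>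
  calc φ w + l * edist w u
      ≤ φ w + l * (edist w v + edist v u) := by gcongr; exact edist_triangle w v u
    _ = φ w + l * edist w v + l * edist v u := by ring
    _ ≤ φ v + l * edist v u := by gcongr; exact hw
    _ ≤ φ u := hv

theorem isClosed_descentSet [PseudoEMetricSpace X] {φ : X → ℝ≥0∞} (hφ : LowerSemicontinuous φ)
    {l : ℝ≥0∞} (hl : l ≠ ⊤) (u : X) : IsClosed (descentSet φ l u) :=
  have hdist : Continuous fun v => l * edist v u :=
    (ENNReal.continuous_const_mul hl).comp (continuous_id.edist continuous_const)
  (hφ.add hdist.lowerSemicontinuous).isClosed_preimage (φ u)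

theorem exists_mem_descentSet_forall_edist_le [PseudoEMetricSpace X] {φ : X → ℝ≥0∞} {l : ℝ≥0∞}
    (hl₀ : l ≠ 0) (hl : l ≠ ⊤) {u : X} (hu : φ u ≠ ⊤) {ε : ℝ≥0∞} (hε : ε ≠ 0) :
    ∃ v ∈ descentSet φ l u, ∀ w ∈ descentSet φ l v, edist w v ≤ ε := by
  have hinf : ⨅ w ∈ descentSet φ l u, φ w ≠ ⊤ :=
    ne_top_of_le_ne_top hu (iInf₂_le u (self_mem_descentSet φ l u))
  obtain ⟨v, hv, hvε⟩ : ∃ v ∈ descentSet φ l u, φ v < (⨅ w ∈ descentSet φ l u, φ w) + l * ε := by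
    simpa only [iInf_lt_iff, exists_prop] using ENNReal.lt_add_right hinf (mul_ne_zero hl₀ hε)
  refine ⟨v, hv, fun w hw => ?_⟩
  have hw_top : φ w ≠ ⊤ :=
    ne_top_of_le_ne_top hu ((le_of_mem_descentSet hw).trans (le_of_mem_descentSet hv))
  have hle : φ w + l * edist w v ≤ φ w + l * ε :=
    calc φ w + l * edist w v ≤ φ v := hw
      _ ≤ (⨅ w ∈ descentSet φ l u, φ w) + l * ε := hvε.le
      _ ≤ φ w + l * ε := by gcongr; exact iInf₂_le w (descentSet_subset hv hw)
  exact (ENNReal.mul_le_mul_iff_right hl₀ hl).1 ((ENNReal.add_le_add_iff_left hw_top).1 hle)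

theorem exists_mem_descentSet_eq_singleton [EMetricSpace X] [CompleteSpace X] {φ : X → ℝ≥0∞}
    (hφ : LowerSemicontinuous φ) {l : ℝ≥0∞} (hl₀ : l ≠ 0) (hl : l ≠ ⊤) {x₀ : X}
    (hx₀ : φ x₀ ≠ ⊤) : ∃ s ∈ descentSet φ l x₀, descentSet φ l s = {s} := by
  have exists_next (n : ℕ) (u : {u // φ u ≠ ⊤}) : ∃ v : {v // φ v ≠ ⊤},
      v.1 ∈ descentSet φ l u ∧ ∀ w ∈ descentSet φ l v.1, edist w v ≤ 2⁻¹ ^ n := by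
    obtain ⟨v, hv, hvn⟩ := exists_mem_descentSet_forall_edist_le hl₀ hl u.2
      (pow_ne_zero n (ENNReal.inv_ne_zero.2 ENNReal.ofNat_ne_top) : (2⁻¹ : ℝ≥0∞) ^ n ≠ 0)
    exact ⟨⟨v, ne_top_of_le_ne_top u.2 (le_of_mem_descentSet hv)⟩, hv, hvn⟩
  choose next next_mem edist_next_le using exists_next
  let x : ℕ → {u // φ u ≠ ⊤} := fun n => Nat.rec ⟨x₀, hx₀⟩ next n
  have x_antitone : Antitone fun n => descentSet φ l (x n).1 :=
    antitone_nat_of_succ_le fun n => descentSet_subset (next_mem n (x n))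
  have edist_le {n : ℕ} {w : X} (hw : w ∈ descentSet φ l (x (n + 1)).1) :
      edist w (x (n + 1)) ≤ 2⁻¹ ^ n := edist_next_le n (x n) w hw
  have x_mem {m n : ℕ} (hmn : m ≤ n) : (x n).1 ∈ descentSet φ l (x m).1 :=
    x_antitone hmn (self_mem_descentSet φ l _)
  have x_cauchy : CauchySeq fun n => (x (n + 1)).1 := by
    refine cauchySeq_of_edist_le_geometric 2⁻¹ 1 (ENNReal.inv_lt_one.2 ENNReal.one_lt_two)
      ENNReal.one_ne_top fun n => ?_
    rw [edist_comm, one_mul]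
    exact edist_le (x_mem (Nat.le_succ _))
  obtain ⟨s, hs⟩ := cauchySeq_tendsto_of_complete x_cauchy
  have s_mem (n : ℕ) : s ∈ descentSet φ l (x n).1 :=
    (isClosed_descentSet hφ hl _).mem_of_tendsto hs
      ((eventually_ge_atTop n).mono fun k hk => x_mem (hk.trans (Nat.le_succ k)))
  refine ⟨s, s_mem 0, Set.eq_singleton_iff_unique_mem.2 ⟨self_mem_descentSet φ l s, fun u hu => ?_⟩⟩
  have x_tendsto : Tendsto (fun n => (x (n + 1)).1) atTop (𝓝 u) := by
    refine tendsto_iff_edist_tendsto_0.2 (tendsto_of_tendsto_of_tendsto_of_le_of_le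
      tendsto_const_nhds (ENNReal.tendsto_pow_atTop_nhds_zero_of_lt_one
        (ENNReal.inv_lt_one.2 ENNReal.one_lt_two)) (fun _ => zero_le) fun n => ?_)
    rw [edist_comm]
    exact edist_le (descentSet_subset (s_mem (n + 1)) hu)
  exact tendsto_nhds_unique x_tendsto hs

theorem lowerSemicontinuous_add_coe [TopologicalSpace X] {g : X → EReal}
    (hg : LowerSemicontinuous g) {k : X → ℝ} (hk : Continuous k) :
    LowerSemicontinuous fun x => g x + k x :=
  hg.add' (continuous_coe_real_ereal.comp hk).lowerSemicontinuous fun _ =>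
    EReal.continuousAt_add (.inr (EReal.coe_ne_bot _)) (.inr (EReal.coe_ne_top _))

theorem ekeland_variational_principle [MetricSpace X] [CompleteSpace X] {g : X → EReal}
    (hg : LowerSemicontinuous g) {m : ℝ} (hm : ∀ u, (m : EReal) ≤ g u) {l : ℝ} (hl : 0 < l) {x₀ : X}
    (hx₀ : g x₀ ≠ ⊤) :
    ∃ s, g s ≤ g x₀ ∧ ∀ u, g s ≤ g u + ((l * dist u s : ℝ) : EReal) := by
  let φ : X → ℝ≥0∞ := fun u => (g u - m).toENNReal
  have coe_φ (u : X) : (φ u : EReal) = g u - m :=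
    EReal.coe_toENNReal ((EReal.sub_nonneg (.inr (EReal.coe_ne_top m))
      (.inr (EReal.coe_ne_bot m))).2 (hm u))
  have hφ : LowerSemicontinuous φ :=
    EReal.continuous_toENNReal.comp_lowerSemicontinuous
      (lowerSemicontinuous_add_coe hg (continuous_const (y := -m)))
      fun _ _ => EReal.toENNReal_le_toENNReal
  have hφx₀ : φ x₀ ≠ ⊤ := by
    rw [ne_eq, ← EReal.coe_ennreal_eq_top_iff, coe_φ, sub_eq_add_neg]
    exact EReal.add_ne_top hx₀ (EReal.coe_ne_top (-m))
  have le_of_φ_le {u v : X} (h : φ u ≤ φ v) : g u ≤ g v := by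
    rw [← EReal.coe_ennreal_le_coe_ennreal_iff, coe_φ, coe_φ] at h
    simpa only [EReal.sub_add_cancel] using add_le_add_left h (m : EReal)
  obtain ⟨s, hs₀, hs⟩ := exists_mem_descentSet_eq_singleton hφ
    (ENNReal.ofReal_pos.2 hl).ne' ENNReal.ofReal_ne_top hφx₀
  refine ⟨s, le_of_φ_le (le_of_mem_descentSet hs₀), fun u => ?_⟩
  by_contra! hlt
  have hu : u ∈ descentSet φ (ENNReal.ofReal l) s := by
    change φ u + ENNReal.ofReal l * edist u s ≤ φ s
    rw [edist_dist, ← ENNReal.ofReal_mul hl.le, ← EReal.coe_ennreal_le_coe_ennreal_iff,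
      EReal.coe_ennreal_add, coe_φ, coe_φ, EReal.coe_ennreal_ofReal, max_eq_left (by positivity),
      sub_eq_add_neg, add_right_comm]
    exact EReal.sub_le_sub hlt.le le_rfl
  obtain rfl : u = s := by simpa [hs] using hu
  simp at hlt

end Ekeland

section

variable {E : Type*} [NormedAddCommGroup E] [NormedSpace ℝ E] {f : E → EReal}

theorem conj_le_coe_iff {x' : StrongDual ℝ E} {c : ℝ} :
    conj f x' ≤ c ↔ ∀ u, ((x' u - c : ℝ) : EReal) ≤ f u := by
  refine iSup_le_iff.trans (forall_congr' fun u => ?_)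
  rw [EReal.sub_le_iff_le_add (.inr (EReal.coe_ne_top c)) (.inr (EReal.coe_ne_bot c)), add_comm,
    EReal.coe_sub, EReal.sub_le_iff_le_add (.inl (EReal.coe_ne_bot c)) (.inl (EReal.coe_ne_top c)),
    add_comm]

theorem conj_antitone : Antitone (conj : (E → EReal) → StrongDual ℝ E → EReal) :=
  fun _ _ hfg _ => iSup_mono fun x => EReal.sub_le_sub le_rfl (hfg x)

theorem conj_ne_bot (hf : ∃ x, f x ≠ ⊤) (x' : StrongDual ℝ E) : conj f x' ≠ ⊥ := by
  obtain ⟨x, hx⟩ := hf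
  intro h
  exact hx (by simpa [sub_eq_add_neg, EReal.add_eq_bot_iff] using iSup_eq_bot.1 h x)

theorem le_add_conj {x : E} {x' : StrongDual ℝ E} (hx : f x ≠ ⊥) (hx' : conj f x' ≠ ⊥) :
    ((x' x : ℝ) : EReal) ≤ f x + conj f x' := by
  rw [add_comm, ← EReal.sub_le_iff_le_add (.inl hx) (.inr hx')]
  exact le_iSup (fun x => ((x' x : ℝ) : EReal) - f x) x

theorem conj_add_conj_le_conj_coprod {F : Type*} [NormedAddCommGroup F] [NormedSpace ℝ F]
    (g : F → EReal) (x' : StrongDual ℝ E) (y' : StrongDual ℝ F) :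
    conj f x' + conj g y' ≤ conj (fun p : E × F => f p.1 + g p.2) (x'.coprod y') := by
  refine EReal.add_le_of_forall_lt fun a ha b hb => ?_
  obtain ⟨x, hx⟩ := lt_iSup_iff.1 ha
  obtain ⟨y, hy⟩ := lt_iSup_iff.1 hb
  have hsplit (a b : EReal) (ha : a ≠ ⊤) (hb : b ≠ ⊤) :
      ((x' x : ℝ) - a) + ((y' y : ℝ) - b) ≤ ((x'.coprod y' (x, y) : ℝ) : EReal) - (a + b) := by
    rw [ContinuousLinearMap.coprod_apply]
    induction a with
    | top => exact absurd rfl ha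
    | bot => simp
    | coe a =>
      induction b with
      | top => exact absurd rfl hb
      | bot => simp
      | coe b =>
        norm_cast
        linarith
  calc a + b ≤ ((x' x : ℝ) - f x) + ((y' y : ℝ) - g y) := add_le_add hx.le hy.le
    _ ≤ ((x'.coprod y' (x, y) : ℝ) : EReal) - (f x + g y) :=
        hsplit _ _ (fun h => by simp [h] at hx) (fun h => by simp [h] at hy)
    _ ≤ conj (fun p : E × F => f p.1 + g p.2) (x'.coprod y') :=
        le_iSup (fun p : E × F => ((x'.coprod y' p : ℝ) : EReal) - (f p.1 + g p.2)) (x, y)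

theorem exists_coe_of_mem_subdiff {s : E} {s' : StrongDual ℝ E} (hs : s' ∈ subdiff f s) :
    ∃ a b : ℝ, f s = a ∧ conj f s' = b ∧ a + b = s' s := by
  change f s + conj f s' = _ at hs
  generalize f s = a, conj f s' = b at hs
  induction a <;> induction b <;> simp_all [← EReal.coe_add]

theorem mem_subdiff_iff {s : E} {s' : StrongDual ℝ E} :
    s' ∈ subdiff f s ↔ ∃ a : ℝ, f s = a ∧ ∀ u, ((a + s' (u - s) : ℝ) : EReal) ≤ f u := by
  have affine_eq (a : ℝ) (u : E) : a + s' (u - s) = s' u - (s' s - a) := by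
    rw [map_sub]
    ring
  simp only [affine_eq, ← conj_le_coe_iff]
  constructor
  · intro h
    obtain ⟨a, b, hfs, hconj, hab⟩ := exists_coe_of_mem_subdiff h
    exact ⟨a, hfs, hconj.trans_le (EReal.coe_le_coe_iff.2 (by linarith))⟩
  · rintro ⟨a, hfs, hle⟩
    have hconj : conj f s' = ((s' s - a : ℝ) : EReal) := by
      refine le_antisymm hle ?_
      rw [EReal.coe_sub, ← hfs]
      exact le_iSup (fun x => ((s' x : ℝ) : EReal) - f x) s
    change f s + conj f s' = _
    rw [hfs, hconj, ← EReal.coe_add, add_sub_cancel]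

theorem convex_epigraph
    (hf : ∀ x y : E, ∀ a b : ℝ, 0 < a → 0 < b → a + b = 1 →
      f (a • x + b • y) ≤ (a : EReal) * f x + (b : EReal) * f y) :
    Convex ℝ {p : E × ℝ | f p.1 ≤ (p.2 : EReal)} := by
  rw [convex_iff_forall_pos]
  rintro ⟨u, r⟩ hu ⟨v, q⟩ hv a b ha hb hab
  calc f (a • u + b • v) ≤ (a : EReal) * f u + (b : EReal) * f v := hf u v a b ha hb hab
    _ ≤ (a : EReal) * r + (b : EReal) * q := by
      have ha' : (0 : EReal) ≤ a := mod_cast ha.le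
      have hb' : (0 : EReal) ≤ b := mod_cast hb.le
      exact add_le_add (mul_le_mul_of_nonneg_left hu ha') (mul_le_mul_of_nonneg_left hv hb')
    _ = ((a • r + b • q : ℝ) : EReal) := by
      simp only [smul_eq_mul, EReal.coe_add, EReal.coe_mul]

theorem exists_nonvertical_hyperplane_between (hf : Convex ℝ {p : E × ℝ | f p.1 ≤ (p.2 : EReal)})
    {h : E → ℝ} (hc : Continuous h) (hh : ConcaveOn ℝ Set.univ h) (hle : ∀ u, (h u : EReal) ≤ f u)
    (hproper : ∃ x, f x ≠ ⊤) :
    ∃ (v' : StrongDual ℝ E) (β d : ℝ), 0 < β ∧ (∀ u r, r < h u → v' u + r * β < d) ∧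
      ∀ (u : E) (r : ℝ), f u ≤ r → d ≤ v' u + r * β := by
  let A : Set (E × ℝ) := {p | p.1 ∈ Set.univ ∧ p.2 < h p.1}
  have hA : IsOpen A := by
    simpa [A] using isOpen_lt continuous_snd (hc.comp continuous_fst)
  have hdisj : Disjoint A {p : E × ℝ | f p.1 ≤ (p.2 : EReal)} :=
    Set.disjoint_left.2 fun p hp hfp => (EReal.coe_le_coe_iff.1 ((hle p.1).trans hfp)).not_gt hp.2
  obtain ⟨F, d, hFA, hFf⟩ :=
    geometric_hahn_banach_open hh.convex_strict_hypograph hA hf hdisj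
  let v' : StrongDual ℝ E := F.comp (.inl ℝ E ℝ)
  let β : ℝ := F (0, 1)
  have F_apply (u : E) (r : ℝ) : F (u, r) = v' u + r * β := by
    have : ((u, r) : E × ℝ) = (u, 0) + r • ((0, 1) : E × ℝ) := by simp
    rw [this, map_add, map_smul]
    rfl
  have below (u : E) (r : ℝ) (hr : r < h u) : v' u + r * β < d :=
    F_apply u r ▸ hFA (u, r) ⟨Set.mem_univ u, hr⟩
  have above (u : E) (r : ℝ) (hr : f u ≤ r) : d ≤ v' u + r * β := F_apply u r ▸ hFf (u, r) hr
  refine ⟨v', β, d, ?_, below, above⟩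
  obtain ⟨x, hx⟩ := hproper
  obtain ⟨r, hr, -⟩ := EReal.lt_iff_exists_real_btwn.1 (lt_top_iff_ne_top.2 hx)
  have hhr : h x ≤ r := EReal.coe_le_coe_iff.1 ((hle x).trans hr.le)
  have hlow := below x (h x - 1) (by linarith)
  have hhigh := above x r hr.le
  nlinarith

theorem exists_affine_between (hf : Convex ℝ {p : E × ℝ | f p.1 ≤ (p.2 : EReal)}) {h : E → ℝ}
    (hc : Continuous h) (hh : ConcaveOn ℝ Set.univ h) (hle : ∀ u, (h u : EReal) ≤ f u)
    (hproper : ∃ x, f x ≠ ⊤) :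
    ∃ (s' : StrongDual ℝ E) (c : ℝ), ∀ u, h u ≤ s' u + c ∧ ((s' u + c : ℝ) : EReal) ≤ f u := by
  obtain ⟨v', β, d, hβ, below, above⟩ :=
    exists_nonvertical_hyperplane_between hf hc hh hle hproper
  have affine_eq (u : E) : (-β⁻¹ • v') u + d / β = (d - v' u) / β := by
    simp only [smul_apply, smul_eq_mul]
    ring
  refine ⟨-β⁻¹ • v', d / β, fun u => ⟨?_, ?_⟩⟩
  · rw [affine_eq]
    refine le_of_forall_lt fun r hr => (lt_div_iff₀ hβ).2 ?_
    linarith [below u r hr]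
  · rw [affine_eq]
    refine EReal.le_of_forall_lt_iff_le.1 fun r hr => EReal.coe_le_coe_iff.2 ?_
    rw [div_le_iff₀ hβ]
    linarith [above u r hr.le]

theorem exists_mem_subdiff_neg_mem_subdiff
    (hf : Convex ℝ {p : E × ℝ | f p.1 ≤ (p.2 : EReal)}) {g : E → ℝ} (hgc : Continuous g)
    (hg : ConvexOn ℝ Set.univ g) {s : E} {a : ℝ} (hs : f s = a)
    (hmin : ∀ u, f s + g s ≤ f u + g u) :
    ∃ s' ∈ subdiff f s, -s' ∈ subdiff (fun u => (g u : EReal)) s := by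
  have hle (u : E) : ((a + g s - g u : ℝ) : EReal) ≤ f u := by
    rw [EReal.coe_sub]
    refine EReal.sub_le_of_le_add ?_
    simpa [hs] using hmin u
  obtain ⟨s', c, hs'⟩ := exists_affine_between hf (h := fun u => a + g s - g u) (by fun_prop)
    ((concaveOn_const _ convex_univ).sub hg) hle ⟨s, hs ▸ EReal.coe_ne_top a⟩
  have hc : c = a - s' s := by
    obtain ⟨hge, hle⟩ := hs' s
    rw [hs, EReal.coe_le_coe_iff] at hle
    linarith
  refine ⟨s', mem_subdiff_iff.2 ⟨a, hs, fun u => ?_⟩, mem_subdiff_iff.2 ⟨g s, rfl, fun u => ?_⟩⟩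
  · convert (hs' u).2 using 2
    rw [map_sub, hc]
    ring
  · rw [EReal.coe_le_coe_iff, neg_apply, map_sub]
    linarith [(hs' u).1]

theorem convexOn_norm_sub (v : E) : ConvexOn ℝ Set.univ fun u : E => ‖u - v‖ := by
  simpa only [dist_eq_norm] using convexOn_univ_dist v

theorem IsPCLSC.exists_mem_subdiff_of_add_bddBelow [CompleteSpace E] (hf : IsPCLSC f) {k : E → ℝ}
    (hc : Continuous k) (hk : ConvexOn ℝ Set.univ k) {m : ℝ} (hm : ∀ u, (m : EReal) ≤ f u + k u)
    {u₀ : E} (hu₀ : f u₀ ≠ ⊤) {l : ℝ} (hl : 0 < l) :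
    ∃ s, ∃ s' ∈ subdiff f s, f s + k s ≤ f u₀ + k u₀ ∧
      ∀ u, k s - s' (u - s) ≤ k u + l * ‖u - s‖ := by
  obtain ⟨s, hs₀, hs⟩ := ekeland_variational_principle (lowerSemicontinuous_add_coe hf.lsc hc) hm hl
    (EReal.add_ne_top hu₀ (EReal.coe_ne_top (k u₀)))
  obtain ⟨a, hfs⟩ : ∃ a : ℝ, f s = a := by
    have hfs_top : f s ≠ ⊤ := fun h => by
      rw [h, EReal.top_add_coe, top_le_iff] at hs₀
      exact EReal.add_ne_top hu₀ (EReal.coe_ne_top _) hs₀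
    exact ⟨(f s).toReal, (EReal.coe_toReal hfs_top (hf.ne_bot s)).symm⟩
  let g : E → ℝ := fun u => k u + l * ‖u - s‖
  obtain ⟨s', hs', hg⟩ := exists_mem_subdiff_neg_mem_subdiff (convex_epigraph hf.convex)
    (g := g) (s := s) (by fun_prop) (hk.add ((convexOn_norm_sub s).smul hl.le)) hfs fun u => by
      simpa [g, dist_eq_norm, add_assoc] using hs u
  refine ⟨s, s', hs', hs₀, fun u => ?_⟩
  obtain ⟨b, hgs, hg⟩ := mem_subdiff_iff.1 hg
  obtain rfl : g s = b := EReal.coe_injective hgs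
  have hgu : g s + (-s') (u - s) ≤ g u := EReal.coe_le_coe_iff.1 (hg u)
  simpa only [g, sub_self, norm_zero, mul_zero, add_zero, neg_apply, ← sub_eq_add_neg] using hgu

theorem le_add_sq_norm_sub_of_conj_le {y' : StrongDual ℝ E} {c : ℝ} (hc : conj f y' ≤ c)
    (z' : StrongDual ℝ E) (x : E) {ε : ℝ} (hε : 0 < ε) (u : E) :
    (((y' - z') x - c - (‖y' - z'‖ / (2 * ε)) ^ 2 : ℝ) : EReal) ≤
      f u + (((ε * ‖u - x‖) ^ 2 - z' u : ℝ) : EReal) := by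
  let v' : StrongDual ℝ E := y' - z'
  refine le_trans ?_ (add_le_add_left (conj_le_coe_iff.1 hc u) _)
  rw [← EReal.coe_add, EReal.coe_le_coe_iff]
  have hv : v' (x - u) ≤ ‖v'‖ * ‖u - x‖ :=
    (le_abs_self _).trans (norm_sub_rev x u ▸ v'.le_opNorm (x - u))
  have hyoung := two_mul_le_add_sq (‖v'‖ / (2 * ε)) (ε * ‖u - x‖)
  have hmul : 2 * (‖v'‖ / (2 * ε)) * (ε * ‖u - x‖) = ‖v'‖ * ‖u - x‖ := by field_simp
  simp only [v', sub_apply, map_sub] at hv hyoung hmul ⊢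
  linarith

theorem IsPCLSC.exists_mem_subdiff_near [CompleteSpace E] (hf : IsPCLSC f) {y' : StrongDual ℝ E}
    {c : ℝ} (hc : conj f y' ≤ c) (z' : StrongDual ℝ E) (x : E) {u₀ : E} {r₀ : ℝ}
    (hr₀ : f u₀ ≤ r₀) {δ : ℝ} (hδ : 0 < δ) :
    ∃ s, ∃ s' ∈ subdiff f s,
      f s ≤ ((r₀ + z' (s - u₀) + δ : ℝ) : EReal) ∧ (s' - z') (s - x) ≤ δ := by
  obtain ⟨r, hr, rfl⟩ : ∃ r : ℝ, 0 < r ∧ r ^ 2 = δ := ⟨√δ, Real.sqrt_pos.2 hδ, Real.sq_sqrt hδ.le⟩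
  obtain ⟨ε, hε, hεr⟩ := exists_pos_mul_lt hr ‖u₀ - x‖
  let k : E → ℝ := fun u => (ε * ‖u - x‖) ^ 2 - z' u
  have hk : ConvexOn ℝ Set.univ k :=
    (((convexOn_norm_sub x).smul hε.le).pow (fun _ _ => by positivity) 2).sub
      (z'.toLinearMap.concaveOn convex_univ)
  -- The slope `2rε` is absorbed by the penalty: `2 r ε ‖s - x‖ ≤ r ^ 2 + (ε ‖s - x‖) ^ 2`.
  obtain ⟨s, s', hs', hfs, hsub⟩ := hf.exists_mem_subdiff_of_add_bddBelow (by fun_prop) hk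
    (le_add_sq_norm_sub_of_conj_le hc z' x hε) (ne_top_of_le_ne_top (EReal.coe_ne_top r₀) hr₀)
    (by positivity : 0 < 2 * r * ε)
  refine ⟨s, s', hs', ?_, ?_⟩
  · have hk₀ : k u₀ ≤ r ^ 2 - z' u₀ := by
      have := pow_le_pow_left₀ (by positivity) hεr.le 2
      simp only [k, mul_comm ε]
      linarith
    have hks : -z' s ≤ k s := by
      simp only [k]
      linarith [sq_nonneg (ε * ‖s - x‖)]
    calc f s ≤ ((r₀ + k u₀ - k s : ℝ) : EReal) := by
          rw [EReal.coe_sub, EReal.le_sub_iff_add_le (.inl (EReal.coe_ne_bot _))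
            (.inl (EReal.coe_ne_top _)), EReal.coe_add]
          exact hfs.trans (add_le_add_left hr₀ _)
      _ ≤ ((r₀ + z' (s - u₀) + r ^ 2 : ℝ) : EReal) := by
          rw [EReal.coe_le_coe_iff, map_sub]
          linarith
  · have hx := hsub x
    have := two_mul_le_add_sq r (ε * ‖s - x‖)
    simp only [k, sub_self, norm_zero, norm_sub_rev x s, sub_apply, map_sub] at hx ⊢
    linarith

theorem IsPCLSC.exists_mem_subdiff_of_mem_subdiff_conj [CompleteSpace E] (hf : IsPCLSC f)
    {y' : StrongDual ℝ E} {y'' : StrongDual ℝ (StrongDual ℝ E)} (hy : y'' ∈ subdiff (conj f) y')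
    (w : StrongDual ℝ E) (x : E) {t : ℝ} (ht : 0 < t) :
    ∃ s, ∃ s' ∈ subdiff f s, y'' w ≤ w s + 2 * t ∧ (s' - (y' + t • w)) (s - x) ≤ t ^ 2 := by
  obtain ⟨α, hα, hy⟩ := mem_subdiff_iff.1 hy
  let z' : StrongDual ℝ E := y' + t • w
  obtain ⟨u₀, hu₀⟩ : ∃ u₀, ((α + t * y'' w - t ^ 2 : ℝ) : EReal) < (z' u₀ : ℝ) - f u₀ := by
    refine lt_iSup_iff.1 (lt_of_lt_of_le (EReal.coe_lt_coe_iff.2 ?_) (hy z'))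
    have : y'' (z' - y') = t * y'' w := by simp [z']
    rw [this]
    linarith [pow_pos ht 2]
  have hfu₀ : f u₀ ≤ ((z' u₀ - (α + t * y'' w - t ^ 2) : ℝ) : EReal) := by
    rw [EReal.coe_sub, EReal.le_sub_iff_add_le (.inl (EReal.coe_ne_bot _))
      (.inl (EReal.coe_ne_top _)), add_comm]
    exact EReal.add_le_of_le_sub hu₀.le
  obtain ⟨s, s', hs', hfs, hsub⟩ := hf.exists_mem_subdiff_near hα.le z' x hfu₀
    (pow_pos ht 2)
  refine ⟨s, s', hs', le_of_mul_le_mul_left ?_ ht, hsub⟩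
  have hys := (conj_le_coe_iff.1 hα.le s).trans hfs
  simp only [EReal.coe_le_coe_iff, map_sub, z', add_apply, smul_apply, smul_eq_mul] at hys
  linarith

theorem le_fitzFun {S : E → Set (StrongDual ℝ E)} {s : E} {s' : StrongDual ℝ E} (hs : s' ∈ S s)
    (x : E) (x' : StrongDual ℝ E) :
    ((x' s + s' x - s' s : ℝ) : EReal) ≤ fitzFun S (x, x') :=
  le_iSup₂ (f := fun (s : E × StrongDual ℝ E) (_ : s ∈ graph S) =>
    ((x' s.1 + s.2 x - s.2 s.1 : ℝ) : EReal)) (s, s') hs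

theorem IsPCLSC.le_fitzFun_subdiff [CompleteSpace E] (hf : IsPCLSC f) {y' : StrongDual ℝ E}
    {y'' : StrongDual ℝ (StrongDual ℝ E)} (hy : y'' ∈ subdiff (conj f) y') (x : E)
    (x' : StrongDual ℝ E) :
    ((y' x + y'' x' - y'' y' : ℝ) : EReal) ≤ fitzFun (subdiff f) (x, x') := by
  let w : StrongDual ℝ E := x' - y'
  let bound : ℝ → ℝ := fun t => x' x - (t ^ 2 + (1 - t) * (w x - y'' w + 2 * t))
  have bound_le {t : ℝ} (ht : t ∈ Set.Ioo 0 1) :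
      (bound t : EReal) ≤ fitzFun (subdiff f) (x, x') := by
    obtain ⟨s, s', hs, hw, hsub⟩ := hf.exists_mem_subdiff_of_mem_subdiff_conj hy w x ht.1
    refine le_trans (EReal.coe_le_coe_iff.2 ?_) (le_fitzFun hs x x')
    have hmul : (1 - t) * (w x - w s) ≤ (1 - t) * (w x - y'' w + 2 * t) :=
      mul_le_mul_of_nonneg_left (by linarith) (sub_nonneg.2 ht.2.le)
    simp only [w, bound, sub_apply, add_apply, smul_apply, smul_eq_mul, map_sub] at hsub hmul ⊢
    linarith
  have bound_tendsto : Tendsto (fun t => (bound t : EReal)) (𝓝[>] 0) (𝓝 (bound 0 : EReal)) :=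
    ((continuous_coe_real_ereal.comp (by fun_prop)).tendsto 0).mono_left nhdsWithin_le_nhds
  have bound_zero : bound 0 = y' x + y'' x' - y'' y' := by
    simp only [w, bound, sub_apply, map_sub]
    ring
  rw [← bound_zero]
  exact le_of_tendsto bound_tendsto
    (eventually_of_mem (Ioo_mem_nhdsGT one_pos) fun t ht => bound_le ht)

theorem fitzFun_subdiff_le (p : E × StrongDual ℝ E) :
    fitzFun (subdiff f) p ≤ f p.1 + conj f p.2 := by
  refine iSup₂_le fun ⟨s, s'⟩ hs => ?_
  obtain ⟨a, hfs, hs⟩ := mem_subdiff_iff.1 hs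
  calc ((p.2 s + s' p.1 - s' s : ℝ) : EReal)
      = ((a + s' (p.1 - s) : ℝ) : EReal) + ((p.2 s : ℝ) - f s) := by
        rw [hfs, ← EReal.coe_sub, ← EReal.coe_add, map_sub]
        congr 1
        ring
    _ ≤ f p.1 + conj f p.2 :=
        add_le_add (hs p.1) (le_iSup (fun x => ((p.2 x : ℝ) : EReal) - f x) s)

theorem conj_add_conj_conj_le_conj_fitzFun_subdiff (y' : StrongDual ℝ E)
    (y'' : StrongDual ℝ (StrongDual ℝ E)) :
    conj f y' + conj (conj f) y'' ≤ conj (fitzFun (subdiff f)) (y'.coprod y'') :=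
  (conj_add_conj_le_conj_coprod (conj f) y' y'').trans (conj_antitone fitzFun_subdiff_le _)

theorem graph_nonempty_of_mem_fitzExt {S : E → Set (StrongDual ℝ E)} {y' : StrongDual ℝ E}
    {y'' : StrongDual ℝ (StrongDual ℝ E)} (hy : y'' ∈ fitzExt S y') : (graph S).Nonempty := by
  by_contra hempty
  rw [Set.not_nonempty_iff_eq_empty] at hempty
  have h : conj (fitzFun S) (y'.coprod y'') = ((y'' y' : ℝ) : EReal) := hy
  simp [conj, fitzFun, hempty] at h

theorem fitzExt_subdiff_subset_subdiff_conj (y' : StrongDual ℝ E) :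
    fitzExt (subdiff f) y' ⊆ subdiff (conj f) y' := by
  intro y'' hy
  obtain ⟨⟨s, s'⟩, hs⟩ := graph_nonempty_of_mem_fitzExt hy
  obtain ⟨a, b, hfs, hconj, -⟩ := exists_coe_of_mem_subdiff hs
  exact le_antisymm ((conj_add_conj_conj_le_conj_fitzFun_subdiff y' y'').trans_eq hy)
    (le_add_conj (conj_ne_bot ⟨s, hfs ▸ EReal.coe_ne_top a⟩ y')
      (conj_ne_bot ⟨s', hconj ▸ EReal.coe_ne_top b⟩ y''))

theorem IsPCLSC.subdiff_conj_subset_fitzExt_subdiff [CompleteSpace E] (hf : IsPCLSC f)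
    (y' : StrongDual ℝ E) : subdiff (conj f) y' ⊆ fitzExt (subdiff f) y' := by
  intro y'' hy
  refine le_antisymm (conj_le_coe_iff.2 fun ⟨x, x'⟩ => ?_) ?_
  · simpa using hf.le_fitzFun_subdiff hy x x'
  · exact hy.symm.trans_le (conj_add_conj_conj_le_conj_fitzFun_subdiff y' y'')

end

end FitzExt

theorem mainTheorem5 {E : Type*} [NormedAddCommGroup E] [NormedSpace ℝ E] [CompleteSpace E]
    (f : E → EReal) (hf : FitzExt.IsPCLSC f) :
    FitzExt.fitzExt (FitzExt.subdiff f) = FitzExt.subdiff (FitzExt.conj f) := by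
  funext y'
  exact Set.Subset.antisymm (FitzExt.fitzExt_subdiff_subset_subdiff_conj y')
    (hf.subdiff_conj_subset_fitzExt_subdiff y')
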